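/- Let $k$ be a field and let $1\le a\le\infty$. A graded tdvr of length $a$ over $k$ is a commutative graded $k$-algebra $A=\bigoplus_{0\le i<a}A_i$ with $A_0=k$ in which every $A_i$ ($0\le i<a$) is a one-dimensional $k$-vector space generated by $(A_1)^i$; that is, $A\cong k[\varpi]/(\varpi^a)$ if $a<\infty$ and $A\cong k[\varpi]$ if $a=\infty$, with $A_i=k\varpi^i$. Let $A$ be a graded tdvr of length $a$, let $R=A[x_1,\dots,x_n]$, and let $L=Re_1\oplus\cdots\oplus Re_r$ be a free $R$-module. Let $\mathbb X_e$ be the set of power products $X=x_1^{m_1}\cdots x_n^{m_n}e_l$ of $L$, and write $X\mid Y$ if $Y=\boldsymbol x X$ for a power product $\boldsymbol x$ of $R$. Fix a term order on $\mathbb X_e$, that is, a total order such that $X<\boldsymbol xX$ for every $\boldsymbol x\ne1$, and such that $X<Y$ implies $\boldsymbol xX<\boldsymbol xY$. For $0\ne f\in L$ let $\operatorname{lp}(f)$, $\operatorname{lc}(f)$ and $\operatorname{lt}(f)=\operatorname{lc}(f)\operatorname{lp}(f)$ be its leading power product, leading coefficient and leading term. Grade $L=\bigoplus_{0\le i<a}L_i$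 by letting $L_i$ be the set of elements all of whose coefficients lie in $A_i$. Let $M$ be a graded $R$-submodule of $L$, i.e. $M=\bigoplus_i (M\cap L_i)$, and let $G=\{g_1,\dots,g_t\}\subset M\smallsetminus\{0\}$ be a homogeneous Gröbner basis for $M$: each $g_j$ lies in some $L_i$, and the leading terms of the elements of $G$ generate the same $R$-submodule of $L$ as the leading terms of all non-zero elements of $M$. Put $c_j=\operatorname{lc}(g_j)$ and $X_j=\operatorname{lp}(g_j)$. For $X\in\mathbb X_e$ let $\mathfrak i_X$ be the ideal of $A$ generated by the $c_j$ with $X_j\mid X$ (so $\mathfrak i_X=0$ if there are none), and let $m_X\in\{0,1,\dots,\infty\}$ be the length of the $A$-module $A/\mathfrak i_X$. Then the following conditions are equivalent: (a) $L/M$ is flat over $A$; (b) $m_X\in\{0,a\}$ for every $X\in\mathbb X_e$; (c) for every $j$ there is a $j'$ such that $c_{j'}$ is a unit of $A$ and $X_{j'}\mid X_j$. Furthermore, if $L/M$ is flat over $A$, then it is a free $A$-module and $$\operatorname{rank}_A(L/M)=\#\{X\in\mathbb X_e\mid m_X=a\}$$ as cardinal numbers. -/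

import Mathlib

universe u v

namespace GroebnerTdvr

section GradedTdvr

variable {k : Type u} [Field k] {A : Type v} [CommRing A] [Algebra k A]

/-- `A = ⨁_{0 ≤ i < a} A_i` is a graded tdvr of length `a ≤ ∞` (`a ≥ 1`): each `A_i` with
`i < a` is a one-dimensional vector space over `A_0 = k` and is generated by `(A_1)^i`
(the case `i = 0` says `A_0 = k · 1`). The grading is indexed by `ℕ`, with `A_i = 0` for `i ≥ a`. -/
structure IsGradedTdvr (𝒜 : ℕ → Submodule k A) [GradedAlgebra 𝒜] (a : ℕ∞) : Prop where
  length_pos : 0 < a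
  finrank_eq_one : ∀ i : ℕ, (i : ℕ∞) < a → Module.finrank k (𝒜 i) = 1
  eq_pow : ∀ i : ℕ, (i : ℕ∞) < a → 𝒜 i = 𝒜 1 ^ i
  eq_bot : ∀ i : ℕ, a ≤ (i : ℕ∞) → 𝒜 i = ⊥

end GradedTdvr

/-- The power product `x^exp · e_comp` of the free module of rank `r` over `A[x_1, …, x_n]`. -/
@[ext]
structure Mon (n r : ℕ) where
  comp : Fin r
  exp : Fin n →₀ ℕ

namespace Mon

variable {n r : ℕ}

/-- Multiplication of the power product `X` of the module by the power product `x^m` of the ring. -/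
noncomputable def shift (m : Fin n →₀ ℕ) (X : Mon n r) : Mon n r := ⟨X.comp, m + X.exp⟩

/-- `X ∣ Y` iff `Y = x^m X` for some `m`. -/
instance : Dvd (Mon n r) := ⟨fun X Y => ∃ m : Fin n →₀ ℕ, Y = shift m X⟩

/-- `(l, m) ↦ x^m e_l`. -/
def ofSigma : (Σ _ : Fin r, Fin n →₀ ℕ) ↪ Mon n r where
  toFun p := ⟨p.1, p.2⟩
  inj' := by
    rintro ⟨_, _⟩ ⟨_, _⟩ h
    cases h
    rfl

end Mon

/-- The given total order on the power products is a term order. -/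
structure IsTermOrder (n r : ℕ) [LinearOrder (Mon n r)] : Prop where
  lt_shift : ∀ (X : Mon n r) (m : Fin n →₀ ℕ), m ≠ 0 → X < X.shift m
  shift_lt_shift : ∀ (X Y : Mon n r) (m : Fin n →₀ ℕ), X < Y → X.shift m < Y.shift m

/-- The free module `L = R e_1 ⊕ ⋯ ⊕ R e_r` over `R = A[x_1, …, x_n]`. -/
abbrev FreeMod (A : Type v) [CommRing A] (n r : ℕ) : Type v := Fin r → MvPolynomial (Fin n) A

section Leading

variable {A : Type v} [CommRing A] {n r : ℕ}

/-- The coefficient of the power product `X` in `f`. -/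
def coeff (f : FreeMod A n r) (X : Mon n r) : A := (f X.comp).coeff X.exp

/-- The term `c X`. -/
noncomputable def term (c : A) (X : Mon n r) : FreeMod A n r :=
  Pi.single X.comp (MvPolynomial.monomial X.exp c)

/-- The finite set of power products that occur in `f` with non-zero coefficient. -/
def support (f : FreeMod A n r) : Finset (Mon n r) :=
  (Finset.univ.sigma fun l => (f l).support).map Mon.ofSigma

variable [LinearOrder (Mon n r)]

/-- The leading power product; `lp 0 = ⊥`. -/
def lp (f : FreeMod A n r) : WithBot (Mon n r) := (support f).max

/-- The leading coefficient; `lc 0 = 0`. -/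
def lc (f : FreeMod A n r) : A := (lp f).recBotCoe 0 (coeff f)

/-- The leading term; `lt 0 = 0`. -/
noncomputable def lt (f : FreeMod A n r) : FreeMod A n r := (lp f).recBotCoe 0 (term (lc f))

/-- `lp f` divides the power product `X` (and `f ≠ 0`). -/
def LpDvd (f : FreeMod A n r) (X : Mon n r) : Prop := ∃ Y : Mon n r, lp f = Y ∧ Y ∣ X

/-- The submodule generated by the leading terms of the elements of a set. -/
noncomputable def Lt (S : Set (FreeMod A n r)) : Submodule (MvPolynomial (Fin n) A) (FreeMod A n r) :=
  Submodule.span (MvPolynomial (Fin n) A) (lt '' S)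

/-- The finite set `G` is a Gröbner basis for `M`: `G ⊆ M ∖ {0}` and `Lt(G) = Lt(M)`. -/
structure IsGroebnerBasis (G : Finset (FreeMod A n r))
    (M : Submodule (MvPolynomial (Fin n) A) (FreeMod A n r)) : Prop where
  subset : ∀ g ∈ G, g ∈ M
  ne_zero : ∀ g ∈ G, g ≠ 0
  Lt_eq : Lt (G : Set (FreeMod A n r)) = Lt (M : Set (FreeMod A n r))

/-- The ideal `𝔦_X` of `A` generated by the `lc g`, `g ∈ G`, with `lp g ∣ X`. -/
def idealAt (G : Finset (FreeMod A n r)) (X : Mon n r) : Ideal A :=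
  Ideal.span {c | ∃ g ∈ G, LpDvd g X ∧ c = lc g}

/-- `m_X`, the length of the `A`-module `A / 𝔦_X`. -/
noncomputable def mAt (G : Finset (FreeMod A n r)) (X : Mon n r) : ℕ∞ :=
  Module.length A (A ⧸ idealAt G X)

end Leading

section Graded

variable {k : Type u} [Field k] {A : Type v} [CommRing A] [Algebra k A]

/-- `L_i`, the elements of `L` all of whose coefficients lie in `A_i`. -/
def homogPart (𝒜 : ℕ → Submodule k A) (n r i : ℕ) : Submodule k (FreeMod A n r) where
  carrier := {f | ∀ X : Mon n r, coeff f X ∈ 𝒜 i}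
  add_mem' hf hg X := by
    simpa [coeff] using add_mem (hf X) (hg X)
  zero_mem' X := by simp [coeff]
  smul_mem' c f hf X := by
    simpa [coeff] using (𝒜 i).smul_mem c (hf X)

/-- `M` is a graded submodule of `L`: it is the (automatically direct) sum of the `M ∩ L_i`. -/
def IsGradedSubmodule (𝒜 : ℕ → Submodule k A) {n r : ℕ}
    (M : Submodule (MvPolynomial (Fin n) A) (FreeMod A n r)) : Prop :=
  M.restrictScalars k = ⨆ i : ℕ, M.restrictScalars k ⊓ homogPart 𝒜 n r i

/-- Every element of `G` is homogeneous. -/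
def IsHomogeneousSet (𝒜 : ℕ → Submodule k A) {n r : ℕ} (G : Finset (FreeMod A n r)) : Prop :=
  ∀ g ∈ G, ∃ i : ℕ, g ∈ homogPart 𝒜 n r i

end Graded

end GroebnerTdvr

open GroebnerTdvr

namespace GroebnerTdvr

/-! ### Powers of a uniformizer and lengths over a graded tdvr. -/

section Uniformizer

variable {k : Type u} [Field k] {A : Type v} [CommRing A] [Algebra k A]
  {𝒜 : ℕ → Submodule k A} [GradedAlgebra 𝒜] {a : ℕ∞}

/-! By homogeneity each leading coefficient is a unit times `w ^ i` with `i < a`. Hence `m_X = a`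
exactly when no leading power product of `G` divides `X` (`mAt_eq_length_iff`), and `m_X = 0`
exactly when one with unit leading coefficient does. Under (b), the `X` with `m_X = a` give a basis
of `L / M` (`quotientBasis`), so (b) implies freeness and the rank formula.

For (a) ⇒ (c), write `g = w ^ i • f` with `f` of degree 0 and the same leading power product.
Flatness forces `f ∈ M` (`mem_of_flat_of_pow_smul_mem`). As `lc f` is a unit, the Gröbner property
gives `𝔦_X = A` at `X = lp g`, and then one of the generators of `𝔦_X` is a unit. -/

/-- `w` generates `A_1`, so that `A_i = k w ^ i` for all `i`, and `w ^ i = 0` exactly if `a ≤ i`. -/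
structure IsUniformizer (𝒜 : ℕ → Submodule k A) (a : ℕ∞) (w : A) : Prop where
  pow_mem : ∀ i : ℕ, w ^ i ∈ 𝒜 i
  exists_smul : ∀ (i : ℕ), ∀ x ∈ 𝒜 i, ∃ c : k, x = c • w ^ i
  pow_eq_zero_iff : ∀ i : ℕ, w ^ i = 0 ↔ a ≤ i

theorem IsGradedTdvr.exists_uniformizer (hA : IsGradedTdvr 𝒜 a) :
    ∃ w : A, IsUniformizer 𝒜 a w := by
  obtain ⟨w, hw⟩ : ∃ w : A, 𝒜 1 = Submodule.span k {w} := by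
    rcases lt_or_ge ((1 : ℕ) : ℕ∞) a with h | h
    · obtain ⟨v, -, hv⟩ := finrank_eq_one_iff'.mp (hA.finrank_eq_one 1 h)
      refine ⟨v, le_antisymm (fun x hx => ?_) ?_⟩
      · obtain ⟨c, hc⟩ := hv ⟨x, hx⟩
        exact Submodule.mem_span_singleton.mpr ⟨c, congrArg Subtype.val hc⟩
      · simp
    · exact ⟨0, by simp [hA.eq_bot 1 h]⟩
  have hmem : ∀ i : ℕ, w ^ i ∈ 𝒜 i := fun i => by
    have h1 : w ∈ 𝒜 1 := hw ▸ Submodule.mem_span_singleton_self w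
    simpa using SetLike.pow_mem_graded i h1
  have hpow : ∀ i : ℕ, (i : ℕ∞) < a → 𝒜 i = Submodule.span k {w ^ i} := fun i hi => by
    rw [hA.eq_pow i hi, hw, Submodule.span_pow, Set.singleton_pow]
  refine ⟨w, hmem, fun i x hx => ?_, fun i => ⟨fun h => ?_, fun h => ?_⟩⟩
  · rcases lt_or_ge (i : ℕ∞) a with h | h
    · rw [hpow i h] at hx
      obtain ⟨c, hc⟩ := Submodule.mem_span_singleton.mp hx
      exact ⟨c, hc.symm⟩
    · rw [hA.eq_bot i h] at hx
      exact ⟨0, by simpa using hx⟩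
  · by_contra! hi
    have h1 := hA.finrank_eq_one i hi
    rw [hpow i hi, h, Submodule.span_zero_singleton, finrank_bot] at h1
    exact zero_ne_one h1
  · have h1 := hmem i
    rwa [hA.eq_bot i h, Submodule.mem_bot] at h1

namespace IsUniformizer

variable {w : A}

omit [GradedAlgebra 𝒜] in
theorem exists_unit_mul (hw : IsUniformizer 𝒜 a w) {i : ℕ} {x : A} (hx : x ∈ 𝒜 i) (h0 : x ≠ 0) :
    (i : ℕ∞) < a ∧ ∃ u : Aˣ, x = u * w ^ i := by
  obtain ⟨c, rfl⟩ := hw.exists_smul i x hx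
  have hc : c ≠ 0 := by
    rintro rfl
    simp at h0
  refine ⟨?_, Units.map (algebraMap k A) (Units.mk0 c hc), by simp [Algebra.smul_def]⟩
  by_contra! h
  rw [(hw.pow_eq_zero_iff i).mpr h] at h0
  simp at h0

theorem span_pow_strictAnti (hw : IsUniformizer 𝒜 a w) {i j : ℕ} (hij : i < j)
    (hi : (i : ℕ∞) < a) : Ideal.span {w ^ j} < Ideal.span {w ^ i} := by
  refine lt_of_le_not_ge
    (Ideal.span_singleton_le_span_singleton.mpr (pow_dvd_pow w hij.le)) fun h => ?_
  obtain ⟨b, hb⟩ := Ideal.span_singleton_le_span_singleton.mp h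
  -- A multiple of `w ^ j` has no component in degree `i < j`.
  have h0 := DirectSum.coe_decompose_mul_of_left_mem_of_not_le (𝒜 := 𝒜) (b := b)
    (hw.pow_mem j) (not_le.mpr hij)
  rw [← hb, DirectSum.decompose_of_mem_same _ (hw.pow_mem i)] at h0
  exact hi.not_ge ((hw.pow_eq_zero_iff i).mp h0)

theorem le_length (hw : IsUniformizer 𝒜 a w) : a ≤ Module.length A A := by
  refine ENat.forall_natCast_le_iff_le.mp fun m hm => ?_
  rw [← WithBot.coe_le_coe, Module.coe_length]
  refine Order.LTSeries.length_le_krullDim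
    -- The exponents run down from `m` to 0, so the ideals increase; every larger ideal of a pair
    -- has exponent below `m ≤ a`.
    (LTSeries.mk m (fun j : Fin (m + 1) => Ideal.span {w ^ (m - j : ℕ)}) fun i j hij => ?_)
  have hij' : (i : ℕ) < j := hij
  have hj := j.2
  refine hw.span_pow_strictAnti (by omega) (lt_of_lt_of_le ?_ hm)
  exact_mod_cast (by omega : m - (j : ℕ) < m)

/-- The classes of `1, …, w ^ (m - 1)` span `A ⧸ I` over `k`, and chains of `A`-submodules are
chains of `k`-subspaces. -/
theorem length_quotient_le (hw : IsUniformizer 𝒜 a w) (I : Ideal A) {m : ℕ} (hm : w ^ m ∈ I) :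
    Module.length A (A ⧸ I) ≤ m := by
  have hspan : (⊤ : Submodule k (A ⧸ I)) ≤
      Submodule.span k (Set.range fun i : Fin m => Ideal.Quotient.mk I (w ^ (i : ℕ))) := by
    rintro x -
    obtain ⟨x, rfl⟩ := Ideal.Quotient.mk_surjective x
    induction x using DirectSum.Decomposition.inductionOn 𝒜 with
    | zero => simp
    | @homogeneous i x =>
      obtain ⟨c, hc⟩ := hw.exists_smul i x x.2
      have : Ideal.Quotient.mk I (x : A) = c • Ideal.Quotient.mk I (w ^ i) := by
        rw [hc]; rfl
      rw [this]
      refine Submodule.smul_mem _ _ ?_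
      rcases lt_or_ge i m with h | h
      · exact Submodule.subset_span ⟨⟨i, h⟩, rfl⟩
      · rw [Ideal.Quotient.eq_zero_iff_mem.mpr (I.mem_of_dvd (pow_dvd_pow w h) hm)]
        exact Submodule.zero_mem _
    | add x y hx hy =>
      rw [map_add]
      exact Submodule.add_mem _ hx hy
  have hfin : Module.Finite k (A ⧸ I) := ⟨⟨(Set.finite_range _).toFinset, by
    rw [Set.Finite.coe_toFinset]
    exact top_le_iff.mp hspan⟩⟩
  have hle : Module.length A (A ⧸ I) ≤ Module.length k (A ⧸ I) := by
    rw [← WithBot.coe_le_coe, Module.coe_length, Module.coe_length]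
    exact Order.krullDim_le_of_strictMono (Submodule.restrictScalars k)
      (Submodule.restrictScalarsEmbedding k A (A ⧸ I)).strictMono
  refine hle.trans ?_
  rw [Module.length_eq_finrank]
  have := finrank_range_le_card (R := k) fun i : Fin m => Ideal.Quotient.mk I (w ^ (i : ℕ))
  rw [Set.finrank, top_le_iff.mp hspan, finrank_top, Fintype.card_fin] at this
  exact_mod_cast this

theorem length_eq (hw : IsUniformizer 𝒜 a w) : Module.length A A = a := by
  refine le_antisymm ?_ hw.le_length
  induction a using ENat.recTopCoe with
  | top => exact le_top
  | coe m =>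
    rw [← (Submodule.quotEquivOfEqBot (⊥ : Ideal A) rfl).length_eq]
    exact hw.length_quotient_le ⊥ ((hw.pow_eq_zero_iff m).mpr le_rfl)

theorem length_quotient_bot (hw : IsUniformizer 𝒜 a w) :
    Module.length A (A ⧸ (⊥ : Ideal A)) = a := by
  rw [(Submodule.quotEquivOfEqBot (⊥ : Ideal A) rfl).length_eq, hw.length_eq]

/-- The degree `i` component of `w ^ i * z` is `w ^ i` times the scalar `z_0`, and `w ^ i ≠ 0`. -/
theorem proj_zero_eq_zero_of_pow_mul_eq_zero (hw : IsUniformizer 𝒜 a w) {i : ℕ}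
    (hi : (i : ℕ∞) < a) {z : A} (hz : w ^ i * z = 0) : GradedRing.projZeroRingHom 𝒜 z = 0 := by
  have h0 := DirectSum.coe_decompose_mul_of_left_mem_of_le (𝒜 := 𝒜) (b := z)
    (hw.pow_mem i) le_rfl
  rw [hz, Nat.sub_self] at h0
  obtain ⟨c, hc⟩ := hw.exists_smul 0 _ (DirectSum.decompose 𝒜 z 0).2
  rw [GradedRing.projZeroRingHom_apply]
  rw [hc] at h0 ⊢
  by_cases h : c = 0
  · simp [h]
  · have h1 : c • w ^ i = 0 := by simpa using h0.symm
    exact absurd ((hw.pow_eq_zero_iff i).mp ((smul_eq_zero_iff_right h).mp h1)) hi.not_ge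

end IsUniformizer

end Uniformizer

/-! ### Coefficients, term orders and the ideals `𝔦_X`. -/

section Terms

variable {A : Type v} [CommRing A] {n r : ℕ}

theorem coeff_ext {f g : FreeMod A n r} (h : ∀ X, coeff f X = coeff g X) : f = g := by
  funext l
  ext m
  exact h ⟨l, m⟩

/-- Taking the coefficient of `X`, as a linear map. -/
def coeffHom (A : Type v) [CommRing A] (X : Mon n r) : FreeMod A n r →ₗ[A] A where
  toFun f := coeff f X
  map_add' f g := by simp [coeff]
  map_smul' c f := by simp [coeff]

theorem coeffHom_apply (X : Mon n r) (f : FreeMod A n r) : coeffHom A X f = coeff f X := rfl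

theorem coeff_term [DecidableEq (Mon n r)] (c : A) (X Y : Mon n r) :
    coeff (term c X) Y = if Y = X then c else 0 := by
  rcases X with ⟨l, m⟩
  rcases Y with ⟨l', m'⟩
  rcases eq_or_ne l' l with rfl | h
  · by_cases hm : m = m'
    · simp [coeff, term, hm]
    · simp [coeff, term, hm, Ne.symm hm]
  · simp [coeff, term, h]

theorem mem_support {f : FreeMod A n r} {X : Mon n r} : X ∈ support f ↔ coeff f X ≠ 0 := by
  rcases X with ⟨l, m⟩
  simp only [support, Mon.ofSigma, Finset.mem_map, Finset.mem_sigma, Finset.mem_univ, true_and,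
    MvPolynomial.mem_support_iff, Sigma.exists, coeff]
  refine ⟨?_, fun h => ⟨l, m, h, rfl⟩⟩
  rintro ⟨_, _, h, heq⟩
  cases heq
  exact h

theorem eq_sum_smul_term (f : FreeMod A n r) :
    f = ∑ X ∈ support f, coeff f X • term (1 : A) X := by
  classical
  refine coeff_ext fun Y => ?_
  rw [← coeffHom_apply Y (∑ _ ∈ _, _), map_sum]
  simp only [map_smul, coeffHom_apply, coeff_term, smul_eq_mul, mul_ite, mul_one, mul_zero]
  rw [Finset.sum_ite_eq, eq_comm, ite_eq_left_iff, mem_support, not_not]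
  exact Eq.symm

theorem coeff_monomial_smul_shift (m : Fin n →₀ ℕ) (c : A) (f : FreeMod A n r) (X : Mon n r) :
    coeff (MvPolynomial.monomial m c • f) (X.shift m) = c * coeff f X := by
  simp [coeff, Mon.shift, MvPolynomial.coeff_monomial_mul]

theorem eq_shift_of_coeff_monomial_smul_ne_zero {m : Fin n →₀ ℕ} {c : A} {f : FreeMod A n r}
    {X : Mon n r} (h : coeff (MvPolynomial.monomial m c • f) X ≠ 0) :
    ∃ Y ∈ support f, X = Y.shift m := by
  simp only [coeff, Pi.smul_apply, smul_eq_mul, MvPolynomial.coeff_monomial_mul'] at h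
  split_ifs at h with hm
  · refine ⟨⟨X.comp, X.exp - m⟩, mem_support.mpr (right_ne_zero_of_mul h), ?_⟩
    ext1
    · rfl
    · exact (add_tsub_cancel_of_le hm).symm
  · exact absurd rfl h

theorem Mon.dvd_trans {X Y Z : Mon n r} (h : X ∣ Y) (h' : Y ∣ Z) : X ∣ Z := by
  obtain ⟨m, rfl⟩ := h
  obtain ⟨m', rfl⟩ := h'
  exact ⟨m' + m, by simp [Mon.shift, add_assoc]⟩

theorem Mon.dvd_refl (X : Mon n r) : X ∣ X := ⟨0, by simp [Mon.shift]⟩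

/-- Dickson's lemma, componentwise in the finitely many `e_l`. -/
theorem wellQuasiOrdered_dvd : WellQuasiOrdered fun X Y : Mon n r => X ∣ Y := by
  intro f
  obtain ⟨i, j, hij, h1, h2⟩ :=
    ((Finite.wellQuasiOrdered (Eq : Fin r → Fin r → Prop)).prod
      (wellQuasiOrdered_le (α := Fin n →₀ ℕ))) fun i => ((f i).comp, (f i).exp)
  refine ⟨i, j, hij, (f j).exp - (f i).exp, ?_⟩
  ext1
  · exact h1.symm
  · exact (tsub_add_cancel_of_le h2).symm

variable [LinearOrder (Mon n r)]

theorem IsTermOrder.wellFoundedLT (hord : IsTermOrder n r) : WellFoundedLT (Mon n r) := by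
  refine ⟨RelEmbedding.wellFounded_iff_isEmpty.mpr ⟨fun f => ?_⟩⟩
  obtain ⟨i, j, hij, m, hm⟩ := wellQuasiOrdered_dvd f
  have hlt : f j < f i := f.map_rel_iff.mpr hij
  rcases eq_or_ne m 0 with rfl | h0
  · exact hlt.ne (by rw [hm]; simp [Mon.shift])
  · exact lt_asymm hlt (hm ▸ hord.lt_shift _ m h0)

theorem lp_eq_coe_iff {f : FreeMod A n r} {X : Mon n r} :
    lp f = X ↔ coeff f X ≠ 0 ∧ ∀ Y, coeff f Y ≠ 0 → Y ≤ X := by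
  simp only [← mem_support]
  refine ⟨fun h => ⟨Finset.mem_of_max h, fun Y hY => Finset.le_max_of_eq hY h⟩, fun h => ?_⟩
  exact le_antisymm (Finset.max_le fun Y hY => WithBot.coe_le_coe.mpr (h.2 Y hY))
    (Finset.le_max h.1)

theorem exists_lp_eq {f : FreeMod A n r} (hf : f ≠ 0) : ∃ X : Mon n r, lp f = X := by
  refine Finset.max_of_nonempty (Finset.nonempty_iff_ne_empty.mpr fun h => hf ?_)
  refine coeff_ext fun X => ?_
  by_contra hX
  have := mem_support.mpr hX
  simp [h] at this

theorem lc_eq {f : FreeMod A n r} {X : Mon n r} (h : lp f = X) : lc f = coeff f X := by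
  rw [lc, h]; rfl

theorem lt_eq {f : FreeMod A n r} {X : Mon n r} (h : lp f = X) : lt f = term (coeff f X) X := by
  rw [lt, lc_eq h, h]; rfl

theorem idealAt_mono (G : Finset (FreeMod A n r)) {X Y : Mon n r} (h : X ∣ Y) :
    idealAt G X ≤ idealAt G Y := by
  refine Ideal.span_mono ?_
  rintro c ⟨g, hg, ⟨Z, hZ, hd⟩, rfl⟩
  exact ⟨g, hg, ⟨Z, hZ, Mon.dvd_trans hd h⟩, rfl⟩

/-- Since `𝔦_X` grows along divisibility, the condition on all coefficients defines an
`R`-submodule; it contains each `lt g`. -/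
theorem coeff_mem_idealAt_of_mem_Lt {G : Finset (FreeMod A n r)} {f : FreeMod A n r}
    (hf : f ∈ Lt (G : Set (FreeMod A n r))) (X : Mon n r) : coeff f X ∈ idealAt G X := by
  let N : Submodule (MvPolynomial (Fin n) A) (FreeMod A n r) :=
    { carrier := {f | ∀ X, coeff f X ∈ idealAt G X}
      add_mem' := fun hf hg X => by simpa [coeff] using add_mem (hf X) (hg X)
      zero_mem' := fun X => by simp [coeff]
      smul_mem' := fun p f hf X => by
        have h : coeff (p • f) X = ∑ x ∈ Finset.HasAntidiagonal.antidiagonal X.exp,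
            p.coeff x.1 * coeff f ⟨X.comp, x.2⟩ := by
          simp [coeff, MvPolynomial.coeff_mul]
        rw [h]
        refine Ideal.sum_mem _ fun x hx => Ideal.mul_mem_left _ _ ?_
        refine idealAt_mono G ⟨x.1, ?_⟩ (hf _)
        ext1
        · rfl
        · exact (Finset.HasAntidiagonal.mem_antidiagonal.mp hx).symm }
  have hN : Lt (G : Set (FreeMod A n r)) ≤ N := by
    refine Submodule.span_le.mpr ?_
    rintro _ ⟨g, hg, rfl⟩ Y
    induction hZ : lp g using WithBot.recBotCoe with
    | bot => simp [lt, hZ, coeff]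
    | coe Z =>
      rw [lt_eq hZ, coeff_term]
      split_ifs with h
      · subst h
        exact Ideal.subset_span ⟨g, hg, ⟨Y, hZ, Mon.dvd_refl Y⟩, (lc_eq hZ).symm⟩
      · exact zero_mem _
  exact hN hf X

theorem IsGroebnerBasis.coeff_mem_idealAt {G : Finset (FreeMod A n r)}
    {M : Submodule (MvPolynomial (Fin n) A) (FreeMod A n r)} (hG : IsGroebnerBasis G M)
    {f : FreeMod A n r} (hf : f ∈ M) {X : Mon n r} (hX : lp f = X) :
    coeff f X ∈ idealAt G X := by
  have h : lt f ∈ Lt (G : Set (FreeMod A n r)) :=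
    hG.Lt_eq ▸ Submodule.subset_span ⟨f, hf, rfl⟩
  simpa [lt_eq hX, coeff_term] using coeff_mem_idealAt_of_mem_Lt h X

end Terms

end GroebnerTdvr
namespace GroebnerTdvr

/-! ### A monomial basis of the quotient. -/

section Basis

variable {A : Type v} [CommRing A] {n r : ℕ} [LinearOrder (Mon n r)] {G : Finset (FreeMod A n r)}
  {M : Submodule (MvPolynomial (Fin n) A) (FreeMod A n r)}

/-- The class of the power product `X` in `L / M`. -/
noncomputable def monClass (M : Submodule (MvPolynomial (Fin n) A) (FreeMod A n r)) (X : Mon n r) :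
    FreeMod A n r ⧸ M :=
  M.mkQ.restrictScalars A (term 1 X)

/-- A relation is an element of `M` supported on `B`; if non-zero, its leading coefficient would lie
in a zero ideal `𝔦_Y`. -/
theorem IsGroebnerBasis.linearIndependent_monClass (hG : IsGroebnerBasis G M)
    {B : Set (Mon n r)} (hB : ∀ X ∈ B, idealAt G X = ⊥) :
    LinearIndependent A fun X : B => monClass M (X : Mon n r) := by
  rw [linearIndependent_iff]
  intro l hl
  set f : FreeMod A n r := Finsupp.linearCombination A (fun X : B => term (1 : A) (X : Mon n r)) l
    with hf
  have hmem : f ∈ M := by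
    rw [← Submodule.Quotient.mk_eq_zero, ← hl]
    exact Finsupp.apply_linearCombination A (M.mkQ.restrictScalars A) _ l
  have hcoeff : ∀ Y, coeff f Y = l.sum fun X c => if Y = X then c else 0 := fun Y => by
    rw [hf, ← coeffHom_apply, Finsupp.linearCombination_apply, map_finsuppSum]
    simp [coeffHom_apply, coeff_term]
  have hcoeff' : ∀ X : B, coeff f X = l X := fun X => by
    rw [hcoeff, Finsupp.sum_eq_single X (fun Y _ hY => ?_) (fun _ => by simp)]
    · simp
    · exact if_neg fun h => hY (Subtype.ext h.symm)
  have hf0 : f = 0 := by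
    by_contra h0
    obtain ⟨Y, hY⟩ := exists_lp_eq h0
    have hne := (lp_eq_coe_iff.mp hY).1
    have hYB : Y ∈ B := by
      by_contra hYB
      refine hne ((hcoeff Y).trans (Finset.sum_eq_zero fun X _ => if_neg ?_))
      rintro rfl
      exact hYB X.2
    have hz := hG.coeff_mem_idealAt hmem hY
    rw [hB Y hYB] at hz
    exact hne hz
  ext X
  rw [← hcoeff' X, hf0]
  simp [coeff]

/-- Division by elements with unit leading coefficient, by well-founded induction on the term order.
-/
theorem mem_span_monClass (hord : IsTermOrder n r) (hGM : ∀ g ∈ G, g ∈ M) {B : Set (Mon n r)}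
    (hB : ∀ X ∉ B, ∃ g ∈ G, IsUnit (lc g) ∧ LpDvd g X) (X : Mon n r) :
    monClass M X ∈ Submodule.span A (Set.range fun X : B => monClass M (X : Mon n r)) := by
  have := hord.wellFoundedLT
  induction X using WellFoundedLT.induction with
  | ind X ih =>
  by_cases hX : X ∈ B
  · exact Submodule.subset_span ⟨⟨X, hX⟩, rfl⟩
  obtain ⟨g, hg, ⟨c, hc⟩, Y, hY, m, rfl⟩ := hB X hX
  set p := MvPolynomial.monomial m ((c⁻¹ : Aˣ) : A) • g with hp
  have hpM : p ∈ M := M.smul_mem _ (hGM g hg)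
  have hlead : coeff p (Y.shift m) = 1 := by
    rw [hp, coeff_monomial_smul_shift, ← lc_eq hY, ← hc, Units.inv_mul]
  have hlt : ∀ Z ∈ (support p).erase (Y.shift m), Z < Y.shift m := fun Z hZ => by
    rw [Finset.mem_erase, mem_support] at hZ
    obtain ⟨W, hW, rfl⟩ := eq_shift_of_coeff_monomial_smul_ne_zero hZ.2
    have hle := (lp_eq_coe_iff.mp hY).2 W (mem_support.mp hW)
    exact hord.shift_lt_shift _ _ m (lt_of_le_of_ne hle fun h => hZ.1 (by rw [h]))
  by_cases htriv : (1 : A) = 0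
  · have := subsingleton_of_zero_eq_one htriv.symm
    have := Module.subsingleton A (FreeMod A n r ⧸ M)
    rw [Subsingleton.elim (monClass M _) 0]
    exact zero_mem _
  have hsum : monClass M (Y.shift m) =
      -∑ Z ∈ (support p).erase (Y.shift m), coeff p Z • monClass M Z := by
    have h0 : M.mkQ.restrictScalars A p = 0 := (Submodule.Quotient.mk_eq_zero M).mpr hpM
    rw [eq_sum_smul_term p, map_sum, ← Finset.add_sum_erase _ _
      (mem_support.mpr (by rw [hlead]; exact htriv)), hlead, one_smul] at h0
    simpa only [monClass, map_smul] using eq_neg_of_add_eq_zero_left h0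
  rw [hsum]
  exact neg_mem (Submodule.sum_mem _ fun Z hZ => Submodule.smul_mem _ _ (ih Z (hlt Z hZ)))

/-- The power products in `B` form a basis of `L / M`, provided that `𝔦_X = 0` for every `X` in
`B`, while every other power product is divisible by the leading power product of an element of `G`
whose leading coefficient is a unit. -/
noncomputable def IsGroebnerBasis.quotientBasis (hord : IsTermOrder n r) (hG : IsGroebnerBasis G M)
    (B : Set (Mon n r)) (hB : ∀ X ∈ B, idealAt G X = ⊥)
    (hB' : ∀ X ∉ B, ∃ g ∈ G, IsUnit (lc g) ∧ LpDvd g X) :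
    Module.Basis B A (FreeMod A n r ⧸ M) :=
  Module.Basis.mk (hG.linearIndependent_monClass hB) (by
    rintro x -
    obtain ⟨f, rfl⟩ := M.mkQ_surjective x
    change M.mkQ.restrictScalars A f ∈ _
    rw [eq_sum_smul_term f, map_sum]
    refine Submodule.sum_mem _ fun X _ => ?_
    rw [map_smul]
    exact Submodule.smul_mem _ _ (mem_span_monClass hord hG.subset hB' X))

end Basis

/-! ### Flatness and homogeneity. -/

section Graded

variable {k : Type u} [Field k] {A : Type v} [CommRing A] [Algebra k A]
  {𝒜 : ℕ → Submodule k A} [GradedAlgebra 𝒜] {a : ℕ∞} {n r : ℕ}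
  {M : Submodule (MvPolynomial (Fin n) A) (FreeMod A n r)}

theorem IsGradedSubmodule.exists_proj_zero (hM : IsGradedSubmodule 𝒜 M) {h : FreeMod A n r}
    (hh : h ∈ M) :
    ∃ h₀ ∈ M, ∀ X, coeff h₀ X = GradedRing.projZeroRingHom 𝒜 (coeff h X) := by
  have hh' : h ∈ ⨆ i : ℕ, M.restrictScalars k ⊓ homogPart 𝒜 n r i := hM ▸ hh
  induction hh' using Submodule.iSup_induction' with
  | mem i f hf =>
    rcases eq_or_ne i 0 with rfl | hi
    · exact ⟨f, hf.1, fun X => (DirectSum.decompose_of_mem_same _ (hf.2 X)).symm⟩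
    · refine ⟨0, zero_mem _, fun X => ?_⟩
      rw [GradedRing.projZeroRingHom_apply, DirectSum.decompose_of_mem_ne _ (hf.2 X) hi]
      simp [coeff]
  | zero => exact ⟨0, zero_mem _, fun X => by simp [coeff]⟩
  | add f g hf hg ihf ihg =>
    obtain ⟨f₀, hf₀, hf₀'⟩ := ihf (show f ∈ M.restrictScalars k from hM ▸ hf)
    obtain ⟨g₀, hg₀, hg₀'⟩ := ihg (show g ∈ M.restrictScalars k from hM ▸ hg)
    refine ⟨f₀ + g₀, add_mem hf₀ hg₀, fun X => ?_⟩
    simp only [← coeffHom_apply, map_add] at hf₀' hg₀' ⊢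
    rw [hf₀', hg₀']

/-- The equational criterion yields `f ≡ ∑ z_j l_j` modulo `M` with `w ^ i * z_j = 0`. The `z_j`
have no degree 0 part, so the degree 0 part of `f - ∑ z_j l_j`, which lies in the graded `M`, is
`f`. -/
theorem mem_of_flat_of_pow_smul_mem {w : A} (hw : IsUniformizer 𝒜 a w)
    (hM : IsGradedSubmodule 𝒜 M) [Module.Flat A (FreeMod A n r ⧸ M)] {i : ℕ}
    (hi : (i : ℕ∞) < a) {f : FreeMod A n r} (hf : f ∈ homogPart 𝒜 n r 0) (hfM : w ^ i • f ∈ M) :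
    f ∈ M := by
  have hrel : ∑ _ : Unit, w ^ i • M.mkQ.restrictScalars A f = 0 := by
    rw [Finset.univ_unique, Finset.sum_singleton, ← map_smul]
    exact (Submodule.Quotient.mk_eq_zero M).mpr hfM
  obtain ⟨N, z, y, hy, hz⟩ := Module.Flat.isTrivialRelation_of_sum_smul_eq_zero hrel
  choose l hl using fun j => M.mkQ_surjective (y j)
  have hmem : f - ∑ j, z () j • l j ∈ M := by
    rw [← Submodule.Quotient.mk_eq_zero]
    change M.mkQ.restrictScalars A (f - ∑ j, z () j • l j) = 0
    rw [map_sub, map_sum, sub_eq_zero]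
    refine (hy ()).trans (Finset.sum_congr rfl fun j _ => ?_)
    rw [map_smul, ← hl j]
    rfl
  obtain ⟨h₀, hh₀, hh⟩ := hM.exists_proj_zero hmem
  suffices f = h₀ by rwa [this]
  refine coeff_ext fun X => ?_
  rw [hh, ← coeffHom_apply X (f - _), map_sub, map_sum, map_sub, map_sum]
  have h1 : GradedRing.projZeroRingHom 𝒜 (coeffHom A X f) = coeff f X :=
    DirectSum.decompose_of_mem_same _ (hf X)
  rw [h1, Finset.sum_eq_zero fun j _ => ?_, sub_zero]
  have hzj : w ^ i * z () j = 0 := by simpa using hz j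
  rw [map_smul, smul_eq_mul, map_mul, hw.proj_zero_eq_zero_of_pow_mul_eq_zero hi hzj, zero_mul]

theorem IsUniformizer.exists_eq_pow_smul {w : A} (hw : IsUniformizer 𝒜 a w) {i : ℕ}
    {g : FreeMod A n r} (hg : g ∈ homogPart 𝒜 n r i) :
    ∃ f ∈ homogPart 𝒜 n r 0, w ^ i • f = g ∧ ∀ X, coeff f X ≠ 0 → IsUnit (coeff f X) ∧
      X ∈ support g := by
  classical
  choose c hc using fun X => hw.exists_smul i _ (hg X)
  have hcoeff : ∀ Y, coeff (∑ X ∈ support g, algebraMap k A (c X) • term (1 : A) X) Y =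
      if Y ∈ support g then algebraMap k A (c Y) else 0 := fun Y => by
    rw [← coeffHom_apply, map_sum]
    simp only [map_smul, coeffHom_apply, coeff_term, smul_eq_mul, mul_ite, mul_one, mul_zero]
    rw [Finset.sum_ite_eq]
  -- Restricting to `support g` discards the arbitrary values `c X` may take when `w ^ i = 0`.
  refine ⟨∑ X ∈ support g, algebraMap k A (c X) • term (1 : A) X, fun Y => ?_, ?_, fun Y hY => ?_⟩
  · rw [hcoeff]
    split_ifs
    · exact SetLike.algebraMap_mem_graded 𝒜 _
    · exact zero_mem _
  · refine coeff_ext fun Y => ?_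
    rw [← coeffHom_apply, map_smul, coeffHom_apply, hcoeff]
    split_ifs with h
    · rw [hc Y, smul_eq_mul, mul_comm, ← Algebra.smul_def]
    · rw [smul_zero, eq_comm]
      simpa [mem_support] using h
  · rw [hcoeff] at hY ⊢
    split_ifs at hY ⊢ with h
    · refine ⟨(IsUnit.mk0 (c Y) ?_).map (algebraMap k A), h⟩
      rintro h0
      simp [h0] at hY
    · exact absurd rfl hY

variable [LinearOrder (Mon n r)] {G : Finset (FreeMod A n r)}

/-- Otherwise all generators have positive degree and lie in the proper ideal `(w)`. -/
theorem exists_isUnit_lc_of_idealAt_eq_top {w : A} (hw : IsUniformizer 𝒜 a w) (ha : 0 < a)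
    (hGh : IsHomogeneousSet 𝒜 G) {X : Mon n r} (hX : idealAt G X = ⊤) :
    ∃ g ∈ G, IsUnit (lc g) ∧ LpDvd g X := by
  by_contra! hcon
  have hlt := hw.span_pow_strictAnti zero_lt_one (by simpa using ha)
  refine hlt.not_ge (le_trans le_top (hX.symm.le.trans (Ideal.span_le.mpr ?_)))
  rintro _ ⟨g, hg, ⟨Y, hY, hd⟩, rfl⟩
  obtain ⟨i, hi⟩ := hGh g hg
  obtain ⟨-, u, hu⟩ := hw.exists_unit_mul (hi Y) (lp_eq_coe_iff.mp hY).1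
  rw [lc_eq hY, hu]
  rcases Nat.eq_zero_or_pos i with rfl | hpos
  · refine absurd ⟨Y, hY, hd⟩ (hcon g hg ?_)
    rw [lc_eq hY, hu, pow_zero, mul_one]
    exact u.isUnit
  · exact Ideal.mul_mem_left _ _ (Ideal.mem_span_singleton.mpr (pow_dvd_pow w hpos))

theorem mAt_eq_length_iff {w : A} (hw : IsUniformizer 𝒜 a w) (hGh : IsHomogeneousSet 𝒜 G)
    (X : Mon n r) : mAt G X = a ↔ ∀ g ∈ G, ¬ LpDvd g X := by
  refine ⟨fun h g hg hd => ?_, fun h => ?_⟩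
  · obtain ⟨Y, hY, -⟩ := id hd
    obtain ⟨i, hi⟩ := hGh g hg
    obtain ⟨hia, u, hu⟩ := hw.exists_unit_mul (hi Y) (lp_eq_coe_iff.mp hY).1
    have hmem : w ^ i ∈ idealAt G X := by
      rw [← Ideal.unit_mul_mem_iff_mem _ u.isUnit, ← hu, ← lc_eq hY]
      exact Ideal.subset_span ⟨g, hg, hd, rfl⟩
    -- The length is at most `i`, and `i < a` because `lc g ≠ 0`.
    exact (hw.length_quotient_le _ hmem).not_gt (lt_of_lt_of_eq hia h.symm)
  · have hbot : idealAt G X = ⊥ := by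
      rw [idealAt, Ideal.span_eq_bot]
      rintro _ ⟨g, hg, hd, -⟩
      exact absurd hd (h g hg)
    rw [mAt, hbot, hw.length_quotient_bot]

theorem mAt_eq_zero_iff (X : Mon n r) : mAt G X = 0 ↔ idealAt G X = ⊤ := by
  rw [mAt, Module.length_eq_zero_iff, Ideal.Quotient.subsingleton_iff]

end Graded

end GroebnerTdvr

theorem mainTheorem2 {k : Type u} [Field k] {A : Type v} [CommRing A] [Algebra k A]
    (𝒜 : ℕ → Submodule k A) [GradedAlgebra 𝒜] (a : ℕ∞) (hA : IsGradedTdvr 𝒜 a)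
    (n r : ℕ) [LinearOrder (Mon n r)] (hord : IsTermOrder n r)
    (M : Submodule (MvPolynomial (Fin n) A) (FreeMod A n r)) (hM : IsGradedSubmodule 𝒜 M)
    (G : Finset (FreeMod A n r)) (hG : IsGroebnerBasis G M) (hGh : IsHomogeneousSet 𝒜 G) :
    List.TFAE [
      Module.Flat A (FreeMod A n r ⧸ M),
      ∀ X : Mon n r, mAt G X = 0 ∨ mAt G X = a,
      ∀ g ∈ G, ∃ g' ∈ G, IsUnit (lc g') ∧ ∃ X : Mon n r, lp g = X ∧ LpDvd g' X] ∧
    (Module.Flat A (FreeMod A n r ⧸ M) →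
      Module.Free A (FreeMod A n r ⧸ M) ∧
      Module.rank A (FreeMod A n r ⧸ M) =
        Cardinal.lift.{v} (Cardinal.mk {X : Mon n r // mAt G X = a})) := by
  obtain ⟨w, hw⟩ := hA.exists_uniformizer
  have hnontriv : Nontrivial A := by
    refine ⟨1, 0, fun h => hA.length_pos.not_ge ?_⟩
    simpa using (hw.pow_eq_zero_iff 0).mp (by rw [pow_zero, h])
  have basis : (∀ X : Mon n r, mAt G X = 0 ∨ mAt G X = a) →
      Nonempty (Module.Basis {X : Mon n r | mAt G X = a} A (FreeMod A n r ⧸ M)) := fun hb => by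
    refine ⟨hG.quotientBasis hord _ (fun X hX => ?_) fun X hX => ?_⟩
    · rw [idealAt, Ideal.span_eq_bot]
      rintro _ ⟨g, hg, hd, -⟩
      exact absurd hd ((mAt_eq_length_iff hw hGh X).mp hX g hg)
    · exact exists_isUnit_lc_of_idealAt_eq_top hw hA.length_pos hGh
        ((mAt_eq_zero_iff X).mp ((hb X).resolve_right hX))
  have htfae : List.TFAE [
      Module.Flat A (FreeMod A n r ⧸ M),
      ∀ X : Mon n r, mAt G X = 0 ∨ mAt G X = a,
      ∀ g ∈ G, ∃ g' ∈ G, IsUnit (lc g') ∧ ∃ X : Mon n r, lp g = X ∧ LpDvd g' X] := by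
    tfae_have 1 → 3 := fun hflat g hg => by
      obtain ⟨X, hX⟩ := exists_lp_eq (hG.ne_zero g hg)
      obtain ⟨i, hi⟩ := hGh g hg
      obtain ⟨hne, hmax⟩ := lp_eq_coe_iff.mp hX
      obtain ⟨hia, -⟩ := hw.exists_unit_mul (hi X) hne
      obtain ⟨f, hf, rfl, hfu⟩ := hw.exists_eq_pow_smul hi
      have hfM : f ∈ M := mem_of_flat_of_pow_smul_mem hw hM hia hf (hG.subset _ hg)
      have hfX : coeff f X ≠ 0 := by
        intro h0
        rw [← coeffHom_apply, map_smul, coeffHom_apply, h0, smul_zero] at hne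
        exact hne rfl
      have hlp : lp f = X :=
        lp_eq_coe_iff.mpr ⟨hfX, fun Y hY => hmax Y (mem_support.mp (hfu Y hY).2)⟩
      obtain ⟨g', hg', hu, hd⟩ := exists_isUnit_lc_of_idealAt_eq_top hw hA.length_pos hGh
        (Ideal.eq_top_of_isUnit_mem _ (hG.coeff_mem_idealAt hfM hlp) (hfu X hfX).1)
      exact ⟨g', hg', hu, X, hX, hd⟩
    tfae_have 3 → 2 := fun hc X => by
      by_cases h : ∀ g ∈ G, ¬ LpDvd g X
      · exact Or.inr ((mAt_eq_length_iff hw hGh X).mpr h)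
      push Not at h
      obtain ⟨g, hg, Y, hY, hd⟩ := h
      obtain ⟨g', hg', hu, Y', hY', Z, hZ, hd'⟩ := hc g hg
      obtain rfl : Y = Y' := WithBot.coe_injective (hY.symm.trans hY')
      refine Or.inl ((mAt_eq_zero_iff X).mpr (Ideal.eq_top_of_isUnit_mem _ ?_ hu))
      exact Ideal.subset_span ⟨g', hg', ⟨Z, hZ, Mon.dvd_trans hd' hd⟩, rfl⟩
    tfae_have 2 → 1 := fun hb => by
      obtain ⟨b⟩ := basis hb
      have := Module.Free.of_basis b
      infer_instance
    tfae_finish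
  refine ⟨htfae, fun hflat => ?_⟩
  obtain ⟨b⟩ := basis ((htfae.out 0 1).mp hflat)
  refine ⟨Module.Free.of_basis b, ?_⟩
  have hrank := b.mk_eq_rank
  rw [Cardinal.lift_uzero] at hrank
  exact hrank.symm
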